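/- Let $n,K\ge 1$ be integers, let $\mathcal C$ be a nonempty finite class of $N$ subsets of $\{1,\dots,n\}$, each of cardinality $K$, and let $\mu>0$. Let $\mathbb P_0$ be the law on $\mathbb R^n$ under which the coordinates $X_1,\dots,X_n$ are i.i.d. $\mathcal N(0,1)$, with expectation $\mathbb E_0$. For $S\in\mathcal C$ let $\mathbb P_S$ be the law under which the coordinates are independent, with $X_i\sim\mathcal N(\mu,1)$ for $i\in S$ and $X_i\sim\mathcal N(0,1)$ for $i\notin S$. The risk of a test $f:\mathbb R^n\to\{0,1\}$ is $$R(f)=\mathbb P_0\{f(X)=1\}+\frac1N\sum_{S\in\mathcal C}\mathbb P_S\{f(X)=0\}.$$ Write $X_S=\sum_{i\in S}X_i$, and let $f$ be the maximum (scan) test, defined by $$f(X)=1\quad\text{if and only if}\quad \max_{S\in\mathcal C}X_S\ \ge\ \frac{\mu K+\mathbb E_0\max_{S\in\mathcal C}X_S}{2}.$$ Then, for every $\delta>0$, $R(f)\le\delta$ whenever $$\mu\ \ge\ \frac{\mathbb E_0\max_{S\in\mathcal C}X_S}{K}+2\sqrt{\frac2K\log\frac2\delta}$$ (the square root being read as $0$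 if $\delta>2$, in which case the bound is trivial). -/

import Mathlib

open MeasureTheory ProbabilityTheory

noncomputable section

namespace CombTest

/-- The law `P₀` of the observation under the null hypothesis: the coordinates are i.i.d. `N(0,1)`. -/
def nullLaw (n : ℕ) : Measure (Fin n → ℝ) :=
  Measure.pi fun _ => gaussianReal 0 1

/-- The law `P_S`: the coordinates are independent, `N(μ,1)` inside `S` and `N(0,1)` outside `S`. -/
def altLaw {n : ℕ} (μ : ℝ) (S : Finset (Fin n)) : Measure (Fin n → ℝ) :=
  Measure.pi fun i => gaussianReal (if i ∈ S then μ else 0) 1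

/-- The risk of a binary-valued test `f`: the type I error plus the type II error averaged
over the class `C`. -/
def risk {n : ℕ} (C : Finset (Finset (Fin n))) (μ : ℝ) (f : (Fin n → ℝ) → Fin 2) : ℝ :=
  (nullLaw n).real {x | f x = 1}
    + (1 / (C.card : ℝ)) * ∑ S ∈ C, (altLaw μ S).real {x | f x = 0}

/-- The scan statistic: the maximum over `S ∈ C` of `∑ i ∈ S, x i`. -/
def scan {n : ℕ} (C : Finset (Finset (Fin n))) (hC : C.Nonempty) (x : Fin n → ℝ) : ℝ :=
  C.sup' hC fun S => ∑ i ∈ S, x i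

/-- The expectation of the scan statistic under the null hypothesis. -/
def scanMean {n : ℕ} (C : Finset (Finset (Fin n))) (hC : C.Nonempty) : ℝ :=
  ∫ x, scan C hC x ∂(nullLaw n)

open Classical in
/-- The maximum test: it takes the value `1` (rejects) exactly when the scan statistic is at
least the midpoint of `μ K` and its null expectation. -/
def maxTest {n : ℕ} (C : Finset (Finset (Fin n))) (hC : C.Nonempty) (K : ℕ) (μ : ℝ)
    (x : Fin n → ℝ) : Fin 2 :=
  if (μ * K + scanMean C hC) / 2 ≤ scan C hC x then 1 else 0

/-- The scan statistic is integrable under the null, so `scanMean` is a genuine expectation. -/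
theorem integrable_scan {n : ℕ} (C : Finset (Finset (Fin n))) (hC : C.Nonempty) :
    Integrable (scan C hC) (nullLaw n) := by
  have h1 : ∀ S : Finset (Fin n), Integrable (fun x : Fin n → ℝ => ∑ i ∈ S, x i) (nullLaw n) := by
    intro S
    refine integrable_finsetSum S fun i _ => ?_
    have hp := measurePreserving_eval (fun _ : Fin n => gaussianReal 0 1) i
    have hid : Integrable (id : ℝ → ℝ) (gaussianReal 0 1) :=
      memLp_one_iff_integrable.1 (memLp_id_gaussianReal 1)
    exact hp.integrable_comp_of_integrable hid
  have h2 : scan C hC = C.sup' hC (fun S => fun x : Fin n → ℝ => ∑ i ∈ S, x i) := by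
    funext x
    simp [scan, Finset.sup'_apply]
  rw [h2]
  exact Finset.sup'_induction hC _ (p := fun g => Integrable g (nullLaw n))
    (fun _ ha _ hb => ha.sup hb) (fun S _ => h1 S)

end CombTest

end

/-!
Let `X`, `Y` be independent copies of a centred Gaussian vector, `F` a Lipschitz function whose
gradient has variance at most `σ²` everywhere, and `Λ t = log E exp (t F(X))`. The pair rotates
without changing its law, and `θ ↦ E [exp (a F(X)) exp (b F(cos θ X + sin θ Y))]` joins
`exp (Λ (a + b))` at `θ = 0` to `exp (Λ a + Λ b)` at `θ = π / 2`. Gaussian integration by parts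
evaluates its derivative as `-sin θ` times an integral of covariances of gradients, so for
`0 ≤ a * b` one gets `Λ (a + b) ≤ Λ a + Λ b + a b σ²`. Hence `Λ t - σ² t² / 2` is subadditive on
each half-line and lies below its tangent at `0`, whose slope is the mean of `F`: `F` is
sub-Gaussian with parameter `σ²`, and mollification removes the smoothness of `F`.

The scan statistic is `√K`-Lipschitz by Cauchy–Schwarz, while under `P_S` it dominates the
`N(μ K, K)` variable `∑ i ∈ S, x i`. The threshold being the midpoint of the two centres, both
errors are at most `exp (-t² / (2 K))`, where `t` is half their distance.
-/

open scoped NNReal Topology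

namespace GaussianConcentration

section Growth

variable {V W F G H : Type*} [NormedAddCommGroup V] [NormedAddCommGroup W] [NormedAddCommGroup F]
  [NormedAddCommGroup G] [NormedAddCommGroup H]

/-- At most exponential growth in the norm. Gaussian measures integrate every such function, by
Fernique's theorem. -/
def HasExpGrowth (f : V → F) : Prop :=
  ∃ A B : ℝ≥0, ∀ x, ‖f x‖ ≤ A * Real.exp (B * ‖x‖)

lemma HasExpGrowth.add {f g : V → F} (hf : HasExpGrowth f) (hg : HasExpGrowth g) :
    HasExpGrowth (f + g) := by
  obtain ⟨A, B, hf⟩ := hf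
  obtain ⟨A', B', hg⟩ := hg
  refine ⟨A + A', max B B', fun x => ?_⟩
  calc ‖f x + g x‖ ≤ A * Real.exp (B * ‖x‖) + A' * Real.exp (B' * ‖x‖) :=
        norm_add_le_of_le (hf x) (hg x)
    _ ≤ A * Real.exp (max B B' * ‖x‖) + A' * Real.exp (max B B' * ‖x‖) := by
        gcongr
        exacts [le_max_left _ _, le_max_right _ _]
    _ = _ := by push_cast; ring

lemma HasExpGrowth.of_norm_le_mul {f : V → F} {g : V → G} {h : V → H} (hf : HasExpGrowth f)
    (hg : HasExpGrowth g) (hh : ∀ x, ‖h x‖ ≤ ‖f x‖ * ‖g x‖) : HasExpGrowth h := by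
  obtain ⟨A, B, hf⟩ := hf
  obtain ⟨A', B', hg⟩ := hg
  refine ⟨A * A', B + B', fun x => ?_⟩
  calc ‖h x‖ ≤ (A * Real.exp (B * ‖x‖)) * (A' * Real.exp (B' * ‖x‖)) :=
        (hh x).trans (mul_le_mul (hf x) (hg x) (norm_nonneg _) (by positivity))
    _ = _ := by push_cast; rw [add_mul, Real.exp_add]; ring

lemma HasExpGrowth.mul {f g : V → ℝ} (hf : HasExpGrowth f) (hg : HasExpGrowth g) :
    HasExpGrowth fun x => f x * g x :=
  hf.of_norm_le_mul hg fun _ => norm_mul_le _ _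

lemma HasExpGrowth.clm_apply [NormedSpace ℝ F] [NormedSpace ℝ G] {T : V → F →L[ℝ] G} {u : V → F}
    (hT : HasExpGrowth T) (hu : HasExpGrowth u) : HasExpGrowth fun x => T x (u x) :=
  hT.of_norm_le_mul hu fun _ => ContinuousLinearMap.le_opNorm _ _

lemma norm_le_of_lipschitzWith {f : V → F} {K : ℝ≥0} (hf : LipschitzWith K f) (x : V) :
    ‖f x‖ ≤ ‖f 0‖ + K * ‖x‖ := by
  have h := hf.norm_sub_le x 0
  rw [sub_zero] at h
  linarith [norm_le_norm_add_norm_sub' (f x) (f 0)]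

lemma HasExpGrowth.of_lipschitzWith {f : V → F} {K : ℝ≥0} (hf : LipschitzWith K f) :
    HasExpGrowth f := by
  refine ⟨‖f 0‖₊ + K, 1, fun x => (norm_le_of_lipschitzWith hf x).trans ?_⟩
  calc ‖f 0‖ + K * ‖x‖ ≤ ‖f 0‖ * Real.exp ‖x‖ + K * Real.exp ‖x‖ := by
        gcongr
        · exact le_mul_of_one_le_right (norm_nonneg _) (Real.one_le_exp (norm_nonneg _))
        · linarith [Real.add_one_le_exp ‖x‖]
    _ = _ := by push_cast; ring_nf

lemma HasExpGrowth.comp_lipschitzWith {f : V → F} (hf : HasExpGrowth f) {u : W → V} {K : ℝ≥0}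
    (hu : LipschitzWith K u) : HasExpGrowth (f ∘ u) := by
  obtain ⟨A, B, hf⟩ := hf
  refine ⟨A * (Real.exp (B * ‖u 0‖)).toNNReal, B * K, fun w => ?_⟩
  calc ‖f (u w)‖ ≤ A * Real.exp (B * (‖u 0‖ + K * ‖w‖)) :=
        (hf _).trans (by gcongr; exact norm_le_of_lipschitzWith hu w)
    _ = _ := by
      push_cast
      rw [Real.coe_toNNReal _ (Real.exp_nonneg _), mul_assoc, ← Real.exp_add]
      ring_nf

variable [NormedSpace ℝ V]

lemma HasExpGrowth.of_fderiv [NormedSpace ℝ F] {f : V → F} (hf : Differentiable ℝ f)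
    (hf' : HasExpGrowth (fderiv ℝ f)) : HasExpGrowth f := by
  obtain ⟨A, B, hf'⟩ := hf'
  refine ⟨‖f 0‖₊ + A, B + 1, fun x => ?_⟩
  have mean_value : ‖f x - f 0‖ ≤ A * Real.exp (B * ‖x‖) * ‖x - 0‖ :=
    (convex_closedBall (0 : V) ‖x‖).norm_image_sub_le_of_norm_fderiv_le
      (fun y _ => hf y) (fun y hy => (hf' y).trans (by gcongr; simpa using hy))
      (by simp) (by simp)
  rw [sub_zero] at mean_value
  calc ‖f x‖ ≤ ‖f 0‖ * 1 + A * Real.exp (B * ‖x‖) * ‖x‖ := by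
        linarith [norm_le_norm_add_norm_sub' (f x) (f 0)]
    _ ≤ ‖f 0‖ * Real.exp ((B + 1) * ‖x‖) + A * Real.exp (B * ‖x‖) * Real.exp ‖x‖ := by
        gcongr
        · exact Real.one_le_exp (by positivity)
        · linarith [Real.add_one_le_exp ‖x‖]
    _ = _ := by push_cast; rw [add_mul, mul_assoc, ← Real.exp_add, add_mul, one_mul]

lemma HasExpGrowth.integrable [MeasurableSpace V] [BorelSpace V] [CompleteSpace V]
    [SecondCountableTopology V] {f : V → F} (hf : HasExpGrowth f) {μ : Measure V} [IsGaussian μ]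
    (hm : AEStronglyMeasurable f μ) : Integrable f μ := by
  obtain ⟨A, B, hf⟩ := hf
  obtain ⟨C, hC, hint⟩ := IsGaussian.exists_integrable_exp_sq μ
  refine (hint.const_mul (A * Real.exp (B ^ 2 / (4 * C)))).mono' hm (ae_of_all _ fun x => ?_)
  have young : B * ‖x‖ ≤ B ^ 2 / (4 * C) + C * ‖x‖ ^ 2 := by
    have h : B ^ 2 / (4 * C) + C * ‖x‖ ^ 2 - B * ‖x‖ = (B - 2 * C * ‖x‖) ^ 2 / (4 * C) := by
      field_simp
      ring
    linarith [show 0 ≤ (B - 2 * C * ‖x‖) ^ 2 / (4 * C) by positivity]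
  calc ‖f x‖ ≤ A * Real.exp (B * ‖x‖) := hf x
    _ ≤ A * Real.exp (B ^ 2 / (4 * C) + C * ‖x‖ ^ 2) := by gcongr
    _ = _ := by rw [Real.exp_add]; ring

end Growth

section Tame

variable {V W : Type*} [NormedAddCommGroup V] [NormedSpace ℝ V] [NormedAddCommGroup W]
  [NormedSpace ℝ W]

/-- A `C¹` function whose derivative has at most exponential growth: the class of functions for
which differentiation under a Gaussian integral and Gaussian integration by parts are justified. -/
structure IsTame (f : V → ℝ) : Prop where
  contDiff : ContDiff ℝ 1 f
  growth_fderiv : HasExpGrowth (fderiv ℝ f)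

namespace IsTame

lemma differentiable {f : V → ℝ} (hf : IsTame f) : Differentiable ℝ f :=
  hf.contDiff.differentiable one_ne_zero

lemma continuous_fderiv {f : V → ℝ} (hf : IsTame f) : Continuous (fderiv ℝ f) :=
  hf.contDiff.continuous_fderiv one_ne_zero

lemma growth {f : V → ℝ} (hf : IsTame f) : HasExpGrowth f :=
  HasExpGrowth.of_fderiv hf.differentiable hf.growth_fderiv

lemma of_lipschitzWith {f : V → ℝ} {K : ℝ≥0} (hf : ContDiff ℝ 1 f) (hK : LipschitzWith K f) :
    IsTame f :=
  ⟨hf, K, 0, fun x => by simpa using norm_fderiv_le_of_lipschitz ℝ hK (x₀ := x)⟩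

lemma mul {f g : V → ℝ} (hf : IsTame f) (hg : IsTame g) : IsTame (f * g) := by
  refine ⟨hf.contDiff.mul hg.contDiff, ?_⟩
  have h : fderiv ℝ (f * g) = (fun x => f x • fderiv ℝ g x) + fun x => g x • fderiv ℝ f x :=
    funext fun x => fderiv_mul (hf.differentiable x) (hg.differentiable x)
  rw [h]
  exact (hf.growth.of_norm_le_mul hg.growth_fderiv fun x => (norm_smul _ _).le).add
    (hg.growth.of_norm_le_mul hf.growth_fderiv fun x => (norm_smul _ _).le)

lemma comp_lipschitzWith {f : V → ℝ} (hf : IsTame f) {u : W → V} {K : ℝ≥0} (hu : ContDiff ℝ 1 u)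
    (hK : LipschitzWith K u) : IsTame (f ∘ u) := by
  refine ⟨hf.contDiff.comp hu, ?_⟩
  have hK' : HasExpGrowth (fderiv ℝ u) :=
    ⟨K, 0, fun x => by simpa using norm_fderiv_le_of_lipschitz ℝ hK (x₀ := x)⟩
  refine (hf.growth_fderiv.comp_lipschitzWith hK).of_norm_le_mul hK' fun x => ?_
  rw [fderiv_comp x (hf.differentiable _) (hu.differentiable one_ne_zero x)]
  exact ContinuousLinearMap.opNorm_comp_le _ _

lemma exp_const_mul (a : ℝ) : IsTame fun s : ℝ => Real.exp (a * s) := by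
  refine ⟨by fun_prop, ‖a‖₊, ‖a‖₊, fun s => ?_⟩
  have h : HasDerivAt (fun s : ℝ => Real.exp (a * s)) (Real.exp (a * s) * a) s := by
    simpa only [mul_one] using ((hasDerivAt_id' s).const_mul a).exp
  rw [← norm_deriv_eq_norm_fderiv, h.deriv, norm_mul, Real.norm_of_nonneg (Real.exp_nonneg _),
    mul_comm, coe_nnnorm, ← norm_mul]
  gcongr
  exact Real.le_norm_self _

end IsTame

lemma isTame_exp_mul {F : V → ℝ} {K : ℝ≥0} (hF : ContDiff ℝ 1 F) (hK : LipschitzWith K F) (a : ℝ) :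
    IsTame fun x => Real.exp (a * F x) :=
  (IsTame.exp_const_mul a).comp_lipschitzWith hF hK

lemma fderiv_exp_mul {F : V → ℝ} (hF : Differentiable ℝ F) (a : ℝ) (x : V) :
    fderiv ℝ (fun x => Real.exp (a * F x)) x = (a * Real.exp (a * F x)) • fderiv ℝ F x := by
  rw [((hF x).hasFDerivAt.const_mul a).exp.fderiv, smul_smul, mul_comm]

end Tame

section DerivIntegral

variable {V W : Type*} [NormedAddCommGroup V] [NormedSpace ℝ V] [NormedAddCommGroup W]
  [NormedSpace ℝ W] [MeasurableSpace W] [BorelSpace W] [CompleteSpace W]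
  [SecondCountableTopology W]

lemma IsTame.hasDerivAt_integral_comp {Φ : V → ℝ} (hΦ : IsTame Φ) {S S' : ℝ → W →L[ℝ] V}
    (hS : ∀ θ, HasDerivAt S (S' θ) θ) (hS' : Continuous S') (μ : Measure W) [IsGaussian μ]
    (θ : ℝ) :
    HasDerivAt (fun θ => ∫ w, Φ (S θ w) ∂μ) (∫ w, fderiv ℝ Φ (S θ w) (S' θ w) ∂μ) θ := by
  have hScont : Continuous S := continuous_iff_continuousAt.2 fun θ => (hS θ).continuousAt
  obtain ⟨C, hC⟩ := (isCompact_closedBall θ 1).exists_bound_of_continuousOn hScont.continuousOn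
  obtain ⟨C', hC'⟩ := (isCompact_closedBall θ 1).exists_bound_of_continuousOn hS'.continuousOn
  obtain ⟨A, B, hAB⟩ := hΦ.growth_fderiv
  have hmem : θ ∈ Metric.closedBall θ 1 := Metric.mem_closedBall_self zero_le_one
  lift C to ℝ≥0 using (norm_nonneg _).trans (hC θ hmem)
  lift C' to ℝ≥0 using (norm_nonneg _).trans (hC' θ hmem)
  have hΦc := hΦ.contDiff.continuous
  have hΦ'c := hΦ.continuous_fderiv
  refine (hasDerivAt_integral_of_dominated_loc_of_deriv_le
    (F' := fun θ w => fderiv ℝ Φ (S θ w) (S' θ w))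
    (bound := fun w => A * Real.exp (B * (C * ‖w‖)) * (C' * Real.exp ‖w‖))
    (Metric.closedBall_mem_nhds θ one_pos) (.of_forall fun θ => ?_) ?_ ?_
    (.of_forall fun w φ hφ => ?_) ?_ (.of_forall fun w φ _ => ?_)).2
  · exact (hΦc.comp (S θ).continuous).aestronglyMeasurable
  · exact (hΦ.growth.comp_lipschitzWith (S θ).lipschitz).integrable
      (hΦc.comp (S θ).continuous).aestronglyMeasurable
  · exact ((hΦ'c.comp (S θ).continuous).clm_apply (S' θ).continuous).aestronglyMeasurable
  · have hw : ‖S φ w‖ ≤ C * ‖w‖ := (S φ).le_of_opNorm_le (hC φ hφ) w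
    have hw' : ‖S' φ w‖ ≤ C' * ‖w‖ := (S' φ).le_of_opNorm_le (hC' φ hφ) w
    calc ‖fderiv ℝ Φ (S φ w) (S' φ w)‖ ≤ ‖fderiv ℝ Φ (S φ w)‖ * ‖S' φ w‖ :=
          ContinuousLinearMap.le_opNorm _ _
      _ ≤ A * Real.exp (B * ‖S φ w‖) * (C' * ‖w‖) := by gcongr; exact hAB _
      _ ≤ A * Real.exp (B * (C * ‖w‖)) * (C' * Real.exp ‖w‖) := by
        gcongr
        linarith [Real.add_one_le_exp ‖w‖]
  · refine HasExpGrowth.integrable ⟨A * C', B * C + 1, fun w => le_of_eq ?_⟩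
      (by fun_prop)
    rw [Real.norm_of_nonneg (by positivity)]
    push_cast
    rw [add_mul, Real.exp_add, one_mul]
    ring_nf
  · exact (hΦ.differentiable _).hasFDerivAt.comp_hasDerivAt φ <|
      (ContinuousLinearMap.apply ℝ V w).hasFDerivAt.comp_hasDerivAt φ (hS φ)

end DerivIntegral

section Rotation

variable {E : Type*} [NormedAddCommGroup E] [NormedSpace ℝ E]

lemma rotation_eq_cos_smul_add_sin_smul (θ : ℝ) :
    ContinuousLinearMap.rotation (E := E) θ = Real.cos θ • ContinuousLinearMap.id ℝ (E × E) +
      Real.sin θ • (ContinuousLinearMap.snd ℝ E E).prod (-ContinuousLinearMap.fst ℝ E E) := by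
  refine ContinuousLinearMap.ext fun p => ?_
  simp [ContinuousLinearMap.rotation_apply, Prod.ext_iff, add_comm]

lemma hasDerivAt_rotation (θ : ℝ) :
    HasDerivAt (ContinuousLinearMap.rotation (E := E))
      (ContinuousLinearMap.rotation (θ + Real.pi / 2)) θ := by
  rw [funext rotation_eq_cos_smul_add_sin_smul]
  simp only [Real.cos_add_pi_div_two, Real.sin_add_pi_div_two]
  exact ((Real.hasDerivAt_cos θ).smul_const _).add ((Real.hasDerivAt_sin θ).smul_const
    ((ContinuousLinearMap.snd ℝ E E).prod (-ContinuousLinearMap.fst ℝ E E)))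

lemma continuous_rotation : Continuous (ContinuousLinearMap.rotation (E := E)) :=
  continuous_iff_continuousAt.2 fun θ => (hasDerivAt_rotation θ).continuousAt

lemma rotation_rotation (θ φ : ℝ) (p : E × E) :
    ContinuousLinearMap.rotation θ (ContinuousLinearMap.rotation φ p) =
      ContinuousLinearMap.rotation (θ + φ) p := by
  ext <;> simp only [ContinuousLinearMap.rotation_apply, Real.cos_add, Real.sin_add] <;> module

lemma rotation_add_pi_div_two_fst (θ : ℝ) (p : E × E) :
    (ContinuousLinearMap.rotation (θ + Real.pi / 2) p).1 =
      (ContinuousLinearMap.rotation θ p).2 := by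
  simp only [ContinuousLinearMap.rotation_apply, Real.cos_add_pi_div_two, Real.sin_add_pi_div_two]

variable [MeasurableSpace E] [BorelSpace E] [CompleteSpace E] [SecondCountableTopology E]

lemma integral_comp_rotation {μ : Measure E} [IsGaussian μ] (hμ : μ[id] = 0) (θ : ℝ)
    {f : E × E → ℝ} (hf : Continuous f) :
    ∫ p, f (ContinuousLinearMap.rotation θ p) ∂μ.prod μ = ∫ p, f p ∂μ.prod μ := by
  conv_rhs => rw [← IsGaussian.map_rotation_eq_self hμ θ]
  exact (integral_map (by fun_prop) hf.aestronglyMeasurable).symm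

end Rotation

section Product
variable {V W : Type*} [NormedAddCommGroup V] [NormedSpace ℝ V] [NormedAddCommGroup W]
  [NormedSpace ℝ W]

lemma IsTame.prodMul {f : V → ℝ} {g : W → ℝ} (hf : IsTame f) (hg : IsTame g) :
    IsTame fun p : V × W => f p.1 * g p.2 :=
  (hf.comp_lipschitzWith contDiff_fst LipschitzWith.prod_fst).mul
    (hg.comp_lipschitzWith contDiff_snd LipschitzWith.prod_snd)

lemma fderiv_prodMul_apply {f : V → ℝ} {g : W → ℝ} {p : V × W}
    (hf : DifferentiableAt ℝ f p.1) (hg : DifferentiableAt ℝ g p.2) (v : V × W) :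
    fderiv ℝ (fun p : V × W => f p.1 * g p.2) p v =
      f p.1 * fderiv ℝ g p.2 v.2 + g p.2 * fderiv ℝ f p.1 v.1 := by
  have h := (hf.hasFDerivAt.comp p hasFDerivAt_fst).mul (hg.hasFDerivAt.comp p hasFDerivAt_snd)
  exact DFunLike.congr_fun h.fderiv v

end Product

section Covariance

variable {E : Type*} [NormedAddCommGroup E] [NormedSpace ℝ E] [MeasurableSpace E] [BorelSpace E]

lemma covarianceBilinDual_le_of_self_le {μ : Measure E} {c : ℝ} {L₁ L₂ : StrongDual ℝ E}
    (h₁ : covarianceBilinDual μ L₁ L₁ ≤ c) (h₂ : covarianceBilinDual μ L₂ L₂ ≤ c) :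
    covarianceBilinDual μ L₁ L₂ ≤ c := by
  have h := covarianceBilinDual_self_nonneg (μ := μ) (L₁ - L₂)
  simp only [map_sub, sub_apply, covarianceBilinDual_comm L₂ L₁] at h
  linarith

lemma integrable_covarianceBilinDual_fderiv [SecondCountableTopology E] {W : Type*}
    [NormedAddCommGroup W] [NormedSpace ℝ W] [MeasurableSpace W] [BorelSpace W] [CompleteSpace W]
    [SecondCountableTopology W] {ν : Measure W} [IsGaussian ν] (μ : Measure E) {f g : E → ℝ}
    (hf : IsTame f) (hg : IsTame g) (S T : W →L[ℝ] E) :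
    Integrable (fun w => covarianceBilinDual μ (fderiv ℝ f (S w)) (fderiv ℝ g (T w))) ν := by
  have hf' := hf.continuous_fderiv
  have hg' := hg.continuous_fderiv
  exact HasExpGrowth.integrable (.clm_apply (.clm_apply (.of_lipschitzWith (.const _))
    (hf.growth_fderiv.comp_lipschitzWith S.lipschitz))
    (hg.growth_fderiv.comp_lipschitzWith T.lipschitz)) (by fun_prop)

variable [CompleteSpace E] [SecondCountableTopology E] {μ : Measure E} [IsGaussian μ]

lemma integral_dual_mul_dual (hμ : μ[id] = 0) (L₁ L₂ : StrongDual ℝ E) :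
    ∫ x, L₁ x * L₂ x ∂μ = covarianceBilinDual μ L₁ L₂ := by
  rw [covarianceBilinDual_apply' IsGaussian.memLp_two_id, hμ]
  simp only [sub_zero]

lemma integral_fderiv_swap_neg_eq_zero (hμ : μ[id] = 0) {Φ : E × E → ℝ} (hΦ : IsTame Φ) :
    ∫ p, fderiv ℝ Φ p (p.2, -p.1) ∂μ.prod μ = 0 := by
  have hderiv := hΦ.hasDerivAt_integral_comp hasDerivAt_rotation
    (continuous_rotation.comp (continuous_add_const _)) (μ.prod μ) 0
  simp only [integral_comp_rotation hμ _ hΦ.contDiff.continuous] at hderiv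
  simpa [ContinuousLinearMap.rotation_apply] using hderiv.unique (hasDerivAt_const _ _)

lemma integral_mul_dual (hμ : μ[id] = 0) {f : E → ℝ} (hf : IsTame f) (L : StrongDual ℝ E) :
    ∫ x, f x * L x ∂μ = ∫ x, covarianceBilinDual μ (fderiv ℝ f x) L ∂μ := by
  have hL : IsTame L := .of_lipschitzWith L.contDiff L.lipschitz
  have hfL := hf.mul hL
  have hf' := hf.continuous_fderiv
  have int_left : Integrable (fun p : E × E => f p.1 * L p.1) (μ.prod μ) :=
    (hfL.growth.integrable hfL.contDiff.continuous.aestronglyMeasurable).comp_fst μ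
  have int_right : Integrable (fun p : E × E => fderiv ℝ f p.1 p.2 * L p.2) (μ.prod μ) := by
    have growth_fderiv_apply : HasExpGrowth fun p : E × E => fderiv ℝ f p.1 p.2 :=
      (hf.growth_fderiv.comp_lipschitzWith .prod_fst).clm_apply (.of_lipschitzWith .prod_snd)
    exact (growth_fderiv_apply.mul (.of_lipschitzWith (L.lipschitz.comp .prod_snd))).integrable
      (by fun_prop)
  have hsub : ∫ p, (fderiv ℝ f p.1 p.2 * L p.2 - f p.1 * L p.1) ∂μ.prod μ = 0 := by
    rw [← integral_fderiv_swap_neg_eq_zero hμ (hf.prodMul hL)]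
    refine integral_congr_ae (.of_forall fun p => ?_)
    simp only [fderiv_prodMul_apply (hf.differentiable _) (hL.differentiable _), map_neg,
      ContinuousLinearMap.fderiv]
    ring
  calc ∫ x, f x * L x ∂μ = ∫ p, f p.1 * L p.1 ∂μ.prod μ := by
        simpa using (integral_fun_fst (μ := μ) (ν := μ) fun x => f x * L x).symm
    _ = ∫ p, fderiv ℝ f p.1 p.2 * L p.2 ∂μ.prod μ := by
        rw [integral_sub int_right int_left] at hsub
        linarith
    _ = ∫ x, covarianceBilinDual μ (fderiv ℝ f x) L ∂μ := by
        simp only [integral_prod _ int_right, integral_dual_mul_dual hμ]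

lemma integral_comp_add_smul_mul_dual (hμ : μ[id] = 0) {f : E → ℝ} (hf : IsTame f) (x : E) (s : ℝ)
    (L : StrongDual ℝ E) :
    ∫ y, f (x + s • y) * L y ∂μ = s * ∫ y, covarianceBilinDual μ (fderiv ℝ f (x + s • y)) L ∂μ := by
  have hfx : IsTame fun y => f (x + s • y) :=
    hf.comp_lipschitzWith (by fun_prop) ((LipschitzWith.const x).add (lipschitzWith_smul s))
  have fderiv_fx : ∀ y, fderiv ℝ (fun y => f (x + s • y)) y = s • fderiv ℝ f (x + s • y) :=
    fun y => by
      have h := (hf.differentiable (x + s • y)).hasFDerivAt.comp y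
        (((hasFDerivAt_id y).const_smul s).const_add x)
      rw [ContinuousLinearMap.comp_smul, ContinuousLinearMap.comp_id] at h
      exact h.fderiv
  simp only [integral_mul_dual hμ hfx, fderiv_fx, map_smul, smul_apply, smul_eq_mul,
    integral_const_mul]

lemma integral_mul_fderiv_rotation (hμ : μ[id] = 0) {f g : E → ℝ} (hf : IsTame f) (hg : IsTame g)
    (θ : ℝ) :
    ∫ p, f p.1 * fderiv ℝ g (ContinuousLinearMap.rotation θ p).1
        (ContinuousLinearMap.rotation θ p).2 ∂μ.prod μ =
      -Real.sin θ * ∫ p, covarianceBilinDual μ (fderiv ℝ f p.1)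
        (fderiv ℝ g (ContinuousLinearMap.rotation θ p).1) ∂μ.prod μ := by
  have hf0 := hf.contDiff.continuous
  have hf' := hf.continuous_fderiv
  have hg' := hg.continuous_fderiv
  let R : E × E →L[ℝ] E := (ContinuousLinearMap.fst ℝ E E).comp (.rotation (-θ))
  have R_apply : ∀ x y, R (x, y) = Real.cos θ • x + -Real.sin θ • y := fun x y => by
    simp only [R, ContinuousLinearMap.comp_apply, ContinuousLinearMap.coe_fst',
      ContinuousLinearMap.rotation_apply, Real.cos_neg, Real.sin_neg]
  have R_rotation : ∀ p, R (ContinuousLinearMap.rotation θ p) = p.1 := fun p => by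
    simp only [R, ContinuousLinearMap.comp_apply, rotation_rotation, neg_add_cancel]
    simp [ContinuousLinearMap.rotation_apply]
  have int_left : Integrable (fun q : E × E => f (R q) * fderiv ℝ g q.1 q.2) (μ.prod μ) := by
    refine HasExpGrowth.integrable ?_ (by fun_prop)
    exact (hf.growth.comp_lipschitzWith R.lipschitz).mul
      ((hg.growth_fderiv.comp_lipschitzWith .prod_fst).clm_apply (.of_lipschitzWith .prod_snd))
  have int_right : Integrable (fun q : E × E =>
      covarianceBilinDual μ (fderiv ℝ f (R q)) (fderiv ℝ g q.1)) (μ.prod μ) :=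
    integrable_covarianceBilinDual_fderiv μ hf hg R (.fst ℝ E E)
  calc ∫ p, f p.1 * fderiv ℝ g (ContinuousLinearMap.rotation θ p).1
        (ContinuousLinearMap.rotation θ p).2 ∂μ.prod μ
      = ∫ q, f (R q) * fderiv ℝ g q.1 q.2 ∂μ.prod μ := by
        simpa only [R_rotation] using integral_comp_rotation hμ θ
          (f := fun q => f (R q) * fderiv ℝ g q.1 q.2) (by fun_prop)
    _ = -Real.sin θ *
          ∫ q, covarianceBilinDual μ (fderiv ℝ f (R q)) (fderiv ℝ g q.1) ∂μ.prod μ := by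
        rw [integral_prod _ int_left, integral_prod _ int_right, ← integral_const_mul]
        simp only [R_apply, integral_comp_add_smul_mul_dual hμ hf]
    _ = _ := by
        simpa only [R_rotation] using
          congrArg (-Real.sin θ * ·) (integral_comp_rotation hμ θ (f := fun q =>
            covarianceBilinDual μ (fderiv ℝ f (R q)) (fderiv ℝ g q.1)) (by fun_prop)).symm

lemma hasDerivAt_integral_mul_rotation (hμ : μ[id] = 0) {f g : E → ℝ} (hf : IsTame f)
    (hg : IsTame g) (θ : ℝ) :
    HasDerivAt (fun θ => ∫ p, f p.1 * g (ContinuousLinearMap.rotation θ p).1 ∂μ.prod μ)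
      (-Real.sin θ * ∫ p, covarianceBilinDual μ (fderiv ℝ f p.1)
        (fderiv ℝ g (ContinuousLinearMap.rotation θ p).1) ∂μ.prod μ) θ := by
  rw [← integral_mul_fderiv_rotation hμ hf hg]
  let T : (E × E →L[ℝ] E × E) →L[ℝ] E × E →L[ℝ] E × E :=
    ContinuousLinearMap.compL ℝ (E × E) (E × E) (E × E)
      ((ContinuousLinearMap.inr ℝ E E).comp (.fst ℝ E E))
  convert! (hf.prodMul hg).hasDerivAt_integral_comp
    (S := fun θ => (ContinuousLinearMap.fst ℝ E E).prod 0 + T (.rotation θ))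
    (fun φ => (T.hasFDerivAt.comp_hasDerivAt φ (hasDerivAt_rotation φ)).const_add _)
    (T.continuous.comp (continuous_rotation.comp (continuous_add_const _))) (μ.prod μ) θ
    using 3 with φ p
  · simp [T]
  · simp [T, fderiv_prodMul_apply (hf.differentiable _) (hg.differentiable _),
      rotation_add_pi_div_two_fst]

end Covariance

section CGF

variable {E : Type*} [NormedAddCommGroup E] [NormedSpace ℝ E] [MeasurableSpace E] [BorelSpace E]
  [CompleteSpace E] [SecondCountableTopology E] {μ : Measure E} [IsGaussian μ]

variable {F : E → ℝ} {K : ℝ≥0} {c : ℝ}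

lemma integral_covarianceBilinDual_fderiv_exp_le (hF : ContDiff ℝ 1 F) (hK : LipschitzWith K F)
    (hc : ∀ x, covarianceBilinDual μ (fderiv ℝ F x) (fderiv ℝ F x) ≤ c) {a b : ℝ}
    (hab : 0 ≤ a * b) (θ : ℝ) :
    ∫ p, covarianceBilinDual μ (fderiv ℝ (fun x => Real.exp (a * F x)) p.1)
        (fderiv ℝ (fun x => Real.exp (b * F x)) (ContinuousLinearMap.rotation θ p).1) ∂μ.prod μ ≤
      a * b * c * ∫ p, Real.exp (a * F p.1) *
        Real.exp (b * F (ContinuousLinearMap.rotation θ p).1) ∂μ.prod μ := by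
  have ha := isTame_exp_mul hF hK a
  have hb := isTame_exp_mul hF hK b
  rw [← integral_const_mul]
  let X : E × E →L[ℝ] E := (ContinuousLinearMap.fst ℝ E E).comp (.rotation θ)
  have hint : Integrable (fun p : E × E => Real.exp (a * F p.1) * Real.exp (b * F (X p)))
      (μ.prod μ) := by
    have hF0 := hF.continuous
    exact ((ha.growth.comp_lipschitzWith .prod_fst).mul
      (hb.growth.comp_lipschitzWith X.lipschitz)).integrable (by fun_prop)
  refine integral_mono (integrable_covarianceBilinDual_fderiv μ ha hb (.fst ℝ E E) X)
    (hint.const_mul _) fun p => ?_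
  have hcov := covarianceBilinDual_le_of_self_le (hc p.1)
    (hc (ContinuousLinearMap.rotation θ p).1)
  simp only [fderiv_exp_mul (hF.differentiable one_ne_zero), map_smul, smul_apply, smul_eq_mul]
  have hweight : 0 ≤ a * b * (Real.exp (a * F p.1) *
      Real.exp (b * F (ContinuousLinearMap.rotation θ p).1)) := mul_nonneg hab (by positivity)
  linarith [mul_le_mul_of_nonneg_left hcov hweight]

lemma mgf_add_le (hμ : μ[id] = 0) (hF : ContDiff ℝ 1 F) (hK : LipschitzWith K F)
    (hc : ∀ x, covarianceBilinDual μ (fderiv ℝ F x) (fderiv ℝ F x) ≤ c) {a b : ℝ}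
    (hab : 0 ≤ a * b) :
    mgf F μ (a + b) ≤ Real.exp (a * b * c) * (mgf F μ a * mgf F μ b) := by
  let φ : ℝ → ℝ := fun θ => ∫ p, Real.exp (a * F p.1) *
    Real.exp (b * F (ContinuousLinearMap.rotation θ p).1) ∂μ.prod μ
  have φ_zero : φ 0 = mgf F μ (a + b) := by
    simp only [φ, ContinuousLinearMap.rotation_apply, Real.cos_zero, one_smul, Real.sin_zero,
      zero_smul, add_zero, ← Real.exp_add, ← add_mul]
    simpa [mgf] using integral_fun_fst (μ := μ) (ν := μ) fun x => Real.exp ((a + b) * F x)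
  have φ_pi_div_two : φ (Real.pi / 2) = mgf F μ a * mgf F μ b := by
    simp only [φ, ContinuousLinearMap.rotation_apply, Real.cos_pi_div_two, one_smul,
      Real.sin_pi_div_two, zero_smul, zero_add]
    exact integral_prod_mul (fun x => Real.exp (a * F x)) fun x => Real.exp (b * F x)
  have hφ := fun θ => hasDerivAt_integral_mul_rotation hμ (isTame_exp_mul hF hK a)
    (isTame_exp_mul hF hK b) θ
  have hmono : MonotoneOn (fun θ => Real.exp (-(a * b * c) * Real.cos θ) * φ θ)
      (Set.Icc 0 (Real.pi / 2)) := by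
    have hderiv := fun θ => ((Real.hasDerivAt_cos θ).const_mul (-(a * b * c))).exp.mul (hφ θ)
    refine monotoneOn_of_hasDerivWithinAt_nonneg (convex_Icc _ _)
      (fun θ _ => (hderiv θ).continuousAt.continuousWithinAt)
      (fun θ _ => (hderiv θ).hasDerivWithinAt) fun θ hθ => ?_
    rw [interior_Icc] at hθ
    have hsin : 0 ≤ Real.sin θ :=
      Real.sin_nonneg_of_nonneg_of_le_pi hθ.1.le (by linarith [hθ.2, Real.pi_pos])
    have hcov := integral_covarianceBilinDual_fderiv_exp_le hF hK hc hab θ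
    linarith [mul_le_mul_of_nonneg_left hcov
      (mul_nonneg (Real.exp_nonneg (-(a * b * c) * Real.cos θ)) hsin)]
  have h := hmono (Set.left_mem_Icc.2 (by positivity)) (Set.right_mem_Icc.2 (by positivity))
    (by positivity)
  simp only [Real.cos_zero, mul_one, φ_zero, Real.cos_pi_div_two, mul_zero, Real.exp_zero,
    one_mul, φ_pi_div_two, Real.exp_neg] at h
  rwa [inv_mul_le_iff₀ (Real.exp_pos _)] at h

end CGF

section Subadditive

variable {ψ : ℝ → ℝ}

lemma natCast_mul_le_of_add_le (hadd : ∀ a b, 0 ≤ a * b → ψ (a + b) ≤ ψ a + ψ b)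
    (h0 : ψ 0 = 0) (n : ℕ) (s : ℝ) : ψ (n * s) ≤ n * ψ s := by
  induction n with
  | zero => simp [h0]
  | succ n ih =>
    have h := hadd (n * s) s (by rw [mul_assoc]; exact mul_nonneg n.cast_nonneg (mul_self_nonneg s))
    push_cast
    rw [add_mul, one_mul, add_mul, one_mul]
    linarith

lemma le_mul_of_add_le_of_hasDerivAt (hadd : ∀ a b, 0 ≤ a * b → ψ (a + b) ≤ ψ a + ψ b)
    (h0 : ψ 0 = 0) {m : ℝ} (hψ : HasDerivAt ψ m 0) (t : ℝ) : ψ t ≤ m * t := by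
  have hderiv : HasDerivAt (fun s => ψ (s * t)) (m * t) 0 :=
    HasDerivAt.comp (h₂ := ψ) 0 (by rwa [zero_mul]) (hasDerivAt_mul_const t)
  have hlim := hderiv.tendsto_slope_zero_right.comp
    (tendsto_inv_atTop_nhdsGT_zero.comp (tendsto_natCast_atTop_atTop (R := ℝ)))
  refine ge_of_tendsto hlim ?_
  filter_upwards [Filter.eventually_ne_atTop 0] with n hn
  have h := natCast_mul_le_of_add_le hadd h0 n ((n : ℝ)⁻¹ * t)
  rw [mul_inv_cancel_left₀ (Nat.cast_ne_zero.2 hn)] at h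
  simpa [h0] using h

end Subadditive

section Subgaussian

lemma hasSubgaussianMGF_sub_of_cgf_le {Ω : Type*} {mΩ : MeasurableSpace Ω} {μ : Measure Ω}
    [NeZero μ] {X : Ω → ℝ} {m : ℝ} {c : ℝ≥0}
    (hint : ∀ t, Integrable (fun ω => Real.exp (t * X ω)) μ)
    (hcgf : ∀ t, cgf X μ t ≤ m * t + c * t ^ 2 / 2) :
    HasSubgaussianMGF (fun ω => X ω - m) c μ where
  integrable_exp_mul t := by
    simpa only [mul_sub, Real.exp_sub] using (hint t).div_const (Real.exp (t * m))
  mgf_le t := by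
    simp only [sub_eq_add_neg, mgf_add_const, mul_neg]
    rw [← exp_cgf (hint t), ← Real.exp_add, Real.exp_le_exp]
    linarith [hcgf t]

variable {E : Type*} [NormedAddCommGroup E] [NormedSpace ℝ E] [MeasurableSpace E] [BorelSpace E]
  [CompleteSpace E] [SecondCountableTopology E] {μ : Measure E} [IsGaussian μ]

theorem hasSubgaussianMGF_of_contDiff {F : E → ℝ} {K c : ℝ≥0} (hμ : μ[id] = 0)
    (hF : ContDiff ℝ 1 F) (hK : LipschitzWith K F)
    (hc : ∀ x, covarianceBilinDual μ (fderiv ℝ F x) (fderiv ℝ F x) ≤ c) :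
    HasSubgaussianMGF (fun x => F x - μ[F]) c μ := by
  have hint : ∀ t, Integrable (fun x => Real.exp (t * F x)) μ := fun t =>
    have h := isTame_exp_mul hF hK t
    h.growth.integrable h.contDiff.continuous.aestronglyMeasurable
  have hzero : (0 : ℝ) ∈ interior (integrableExpSet F μ) := by
    rw [Set.eq_univ_of_forall (s := integrableExpSet F μ) hint, interior_univ]
    trivial
  have hderiv : HasDerivAt (fun t => cgf F μ t - c * t ^ 2 / 2) (μ[F]) 0 := by
    have h := (analyticAt_cgf hzero).differentiableAt.hasDerivAt
    rw [deriv_cgf_zero hzero, probReal_univ, div_one] at h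
    simpa using h.fun_sub (((hasDerivAt_pow 2 (0 : ℝ)).const_mul (c : ℝ)).div_const 2)
  refine hasSubgaussianMGF_sub_of_cgf_le hint fun t => ?_
  rw [← sub_le_iff_le_add]
  refine le_mul_of_add_le_of_hasDerivAt (fun a b hab => ?_) (by simp) hderiv t
  have hmgf := mgf_add_le hμ hF hK hc hab
  rw [← exp_cgf (hint _), ← exp_cgf (hint a), ← exp_cgf (hint b), ← Real.exp_add, ← Real.exp_add,
    Real.exp_le_exp] at hmgf
  linarith

end Subgaussian

section Mollification

open scoped Convolution

variable {V W : Type*} [NormedAddCommGroup V] [NormedSpace ℝ V] [FiniteDimensional ℝ V]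
  [MeasurableSpace V] [BorelSpace V] [NormedAddCommGroup W] [NormedSpace ℝ W]

lemma lipschitzWith_normed_convolution (φ : ContDiffBump (0 : V)) {ν : Measure V}
    [ν.IsAddHaarMeasure] {F : V → W} {K : ℝ≥0} (hF : LipschitzWith K F) :
    LipschitzWith K (φ.normed ν ⋆[ContinuousLinearMap.lsmul ℝ ℝ, ν] F : V → W) := by
  have hint : ∀ x, Integrable (fun t => φ.normed ν t • F (x - t)) ν :=
    φ.hasCompactSupport_normed.convolutionExists_left (.lsmul ℝ ℝ) φ.continuous_normed
      hF.continuous.locallyIntegrable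
  refine .of_dist_le_mul fun x y => ?_
  rw [dist_eq_norm, convolution_lsmul, convolution_lsmul, ← integral_sub (hint x) (hint y)]
  calc ‖∫ t, (φ.normed ν t • F (x - t) - φ.normed ν t • F (y - t)) ∂ν‖
      ≤ ∫ t, φ.normed ν t * (K * dist x y) ∂ν := by
        refine norm_integral_le_of_norm_le (φ.integrable_normed.mul_const _)
          (.of_forall fun t => ?_)
        rw [← smul_sub, norm_smul, Real.norm_of_nonneg (φ.nonneg_normed t), ← dist_eq_norm,
          ← dist_sub_right x y t]
        exact mul_le_mul_of_nonneg_left (hF.dist_le_mul _ _) (φ.nonneg_normed t)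
    _ = K * dist x y := by rw [integral_mul_const, φ.integral_normed, one_mul]

lemma exists_contDiff_lipschitzWith_dist_le [CompleteSpace W] {F : V → W} {K : ℝ≥0}
    (hF : LipschitzWith K F) {n : ℕ∞} {ε : ℝ} (hε : 0 < ε) :
    ∃ G : V → W, ContDiff ℝ n G ∧ LipschitzWith K G ∧ ∀ x, dist (G x) (F x) ≤ ε := by
  let r : ℝ := ε / (K + 1)
  have hr : 0 < r := by positivity
  let φ : ContDiffBump (0 : V) := ⟨r / 2, r, half_pos hr, half_lt_self hr⟩
  refine ⟨φ.normed .addHaar ⋆[ContinuousLinearMap.lsmul ℝ ℝ, .addHaar] F,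
    φ.hasCompactSupport_normed.contDiff_convolution_left _ φ.contDiff_normed
      hF.continuous.locallyIntegrable, lipschitzWith_normed_convolution φ hF, fun x => ?_⟩
  refine φ.dist_normed_convolution_le hF.continuous.aestronglyMeasurable fun y hy => ?_
  calc dist (F y) (F x) ≤ K * dist y x := hF.dist_le_mul y x
    _ ≤ (K + 1) * r := by gcongr; exacts [by linarith, (Metric.mem_ball.1 hy).le]
    _ = ε := mul_div_cancel₀ ε (by positivity)

end Mollification

section Lipschitz

lemma hasSubgaussianMGF_of_forall_exists_abs_sub_le {Ω : Type*} {mΩ : MeasurableSpace Ω}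
    {μ : Measure Ω} {X : Ω → ℝ} {c : ℝ≥0} (hX : AEMeasurable X μ)
    (h : ∀ ε > 0, ∃ Y, HasSubgaussianMGF Y c μ ∧ ∀ ω, |X ω - Y ω| ≤ ε) :
    HasSubgaussianMGF X c μ := by
  have exp_mul_le {t x y ε : ℝ} (hxy : |x - y| ≤ ε) :
      Real.exp (t * x) ≤ Real.exp (|t| * ε) * Real.exp (t * y) := by
    rw [← Real.exp_add, Real.exp_le_exp]
    have := (le_abs_self _).trans_eq (abs_mul t (x - y))
    have := mul_le_mul_of_nonneg_left hxy (abs_nonneg t)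
    linarith
  have hint (t : ℝ) : Integrable (fun ω => Real.exp (t * X ω)) μ := by
    obtain ⟨Y, hY, hXY⟩ := h 1 one_pos
    refine ((hY.integrable_exp_mul t).const_mul (Real.exp (|t| * 1))).mono' (by fun_prop)
      (.of_forall fun ω => ?_)
    rw [Real.norm_of_nonneg (Real.exp_nonneg _)]
    exact exp_mul_le (hXY ω)
  refine ⟨hint, fun t => ?_⟩
  have hlim : Filter.Tendsto (fun ε => Real.exp (|t| * ε) * Real.exp (c * t ^ 2 / 2)) (𝓝[>] 0)
      (𝓝 (Real.exp (c * t ^ 2 / 2))) := by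
    have hcont : Continuous fun ε => Real.exp (|t| * ε) * Real.exp (c * t ^ 2 / 2) := by fun_prop
    simpa using (hcont.tendsto 0).mono_left nhdsWithin_le_nhds
  refine ge_of_tendsto hlim (eventually_mem_nhdsWithin.mono fun ε hε => ?_)
  obtain ⟨Y, hY, hXY⟩ := h ε hε
  calc mgf X μ t ≤ ∫ ω, Real.exp (|t| * ε) * Real.exp (t * Y ω) ∂μ :=
        integral_mono (hint t) ((hY.integrable_exp_mul t).const_mul _) fun ω => exp_mul_le (hXY ω)
    _ = Real.exp (|t| * ε) * mgf Y μ t := integral_const_mul _ _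
    _ ≤ Real.exp (|t| * ε) * Real.exp (c * t ^ 2 / 2) := by gcongr; exact hY.mgf_le t

variable {E : Type*} [NormedAddCommGroup E] [InnerProductSpace ℝ E] [FiniteDimensional ℝ E]
  [MeasurableSpace E] [BorelSpace E]

lemma covarianceBilinDual_stdGaussian_self (L : StrongDual ℝ E) :
    covarianceBilinDual (stdGaussian E) L L = ‖L‖ ^ 2 := by
  rw [covarianceBilinDual_self_eq_variance IsGaussian.memLp_two_id, variance_dual_stdGaussian]

theorem hasSubgaussianMGF_of_lipschitzWith {F : E → ℝ} {K : ℝ≥0} (hF : LipschitzWith K F) :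
    HasSubgaussianMGF (fun x => F x - ∫ y, F y ∂stdGaussian E) (K ^ 2) (stdGaussian E) := by
  have hint {G : E → ℝ} (hG : LipschitzWith K G) : Integrable G (stdGaussian E) :=
    (HasExpGrowth.of_lipschitzWith hG).integrable hG.continuous.aestronglyMeasurable
  have hFm := hF.continuous.measurable
  refine hasSubgaussianMGF_of_forall_exists_abs_sub_le (by fun_prop) fun ε hε => ?_
  obtain ⟨G, hGdiff, hG, hGF⟩ := exists_contDiff_lipschitzWith_dist_le hF (n := 1) (half_pos hε)
  refine ⟨_, hasSubgaussianMGF_of_contDiff integral_id_stdGaussian hGdiff hG fun x => ?_,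
    fun x => ?_⟩
  · rw [covarianceBilinDual_stdGaussian_self, NNReal.coe_pow]
    gcongr
    exact norm_fderiv_le_of_lipschitz ℝ hG
  · have hmean : |∫ y, G y ∂stdGaussian E - ∫ y, F y ∂stdGaussian E| ≤ ε / 2 := by
      rw [← integral_sub (hint hG) (hint hF)]
      simpa using norm_integral_le_of_norm_le_const (μ := stdGaussian E) (f := fun x => G x - F x)
        (.of_forall hGF)
    have hx := hGF x
    rw [Real.dist_eq] at hx
    rw [abs_le] at hx hmean ⊢
    constructor <;> linarith

end Lipschitz

end GaussianConcentration

namespace CombTest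

open GaussianConcentration

section Null

variable {n : ℕ} {C : Finset (Finset (Fin n))}

lemma map_toLp_nullLaw :
    (nullLaw n).map (WithLp.toLp 2) = stdGaussian (EuclideanSpace ℝ (Fin n)) :=
  map_pi_eq_stdGaussian

lemma sum_le_scan (hC : C.Nonempty) {S : Finset (Fin n)} (hS : S ∈ C) (x : Fin n → ℝ) :
    ∑ i ∈ S, x i ≤ scan C hC x :=
  Finset.le_sup' (fun S : Finset (Fin n) => ∑ i ∈ S, x i) hS

lemma abs_sum_le_sqrt_card_mul_norm (S : Finset (Fin n)) (x : EuclideanSpace ℝ (Fin n)) :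
    |∑ i ∈ S, x i| ≤ √S.card * ‖x‖ := by
  refine abs_le_of_sq_le_sq ?_ (by positivity)
  rw [mul_pow, Real.sq_sqrt S.card.cast_nonneg, EuclideanSpace.real_norm_sq_eq]
  refine sq_sum_le_card_mul_sum_sq.trans ?_
  gcongr
  exact S.subset_univ

lemma lipschitzWith_scan (hC : C.Nonempty) {K : ℕ} (hcard : ∀ S ∈ C, S.card ≤ K) :
    LipschitzWith (NNReal.sqrt K) fun x : EuclideanSpace ℝ (Fin n) => scan C hC x.ofLp := by
  refine .of_le_add_mul _ fun x y => Finset.sup'_le _ _ fun S hS => ?_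
  calc ∑ i ∈ S, x i = ∑ i ∈ S, y i + ∑ i ∈ S, (x - y) i := by
        simp only [PiLp.sub_apply, Finset.sum_sub_distrib, add_sub_cancel]
    _ ≤ scan C hC y.ofLp + √S.card * ‖x - y‖ :=
        add_le_add (sum_le_scan hC hS y) ((le_abs_self _).trans (abs_sum_le_sqrt_card_mul_norm S _))
    _ ≤ scan C hC y.ofLp + NNReal.sqrt K * dist x y := by
        rw [dist_eq_norm, Real.coe_sqrt, NNReal.coe_natCast]
        gcongr
        exact hcard S hS

lemma hasSubgaussianMGF_scan (hC : C.Nonempty) {K : ℕ} (hcard : ∀ S ∈ C, S.card ≤ K) :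
    HasSubgaussianMGF (fun x => scan C hC x - scanMean C hC) K (nullLaw n) := by
  have hlip := lipschitzWith_scan hC hcard
  have hmean : ∫ x, scan C hC x.ofLp ∂stdGaussian (EuclideanSpace ℝ (Fin n)) = scanMean C hC := by
    rw [← map_toLp_nullLaw, integral_map (by fun_prop) hlip.continuous.aestronglyMeasurable]
    rfl
  have h := hasSubgaussianMGF_of_lipschitzWith hlip
  rw [hmean, ← map_toLp_nullLaw, NNReal.sq_sqrt] at h
  exact h.of_map (Y := WithLp.toLp 2) (by fun_prop)

lemma measureReal_scan_ge_le (hC : C.Nonempty) {K : ℕ} (hcard : ∀ S ∈ C, S.card ≤ K) {t : ℝ}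
    (ht : 0 ≤ t) :
    (nullLaw n).real {x | scanMean C hC + t ≤ scan C hC x} ≤ Real.exp (-t ^ 2 / (2 * K)) := by
  simpa [le_sub_iff_add_le'] using (hasSubgaussianMGF_scan hC hcard).measure_ge_le ht

end Null

section Alternative

variable {n : ℕ}

lemma hasSubgaussianMGF_sub_gaussianReal (m : ℝ) (v : ℝ≥0) :
    HasSubgaussianMGF (fun x => m - x) v (gaussianReal m v) := by
  refine (HasSubgaussianMGF.id_map_iff (by fun_prop)).1 ?_
  rw [gaussianReal_map_const_sub, sub_self]
  refine ⟨integrable_exp_mul_gaussianReal, fun t => ?_⟩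
  simp only [mgf_id_gaussianReal, zero_mul, zero_add, le_refl]

lemma hasSubgaussianMGF_sum_altLaw (μ : ℝ) (S : Finset (Fin n)) :
    HasSubgaussianMGF (fun x => μ * S.card - ∑ i ∈ S, x i) S.card (altLaw μ S) := by
  let m : Fin n → ℝ := fun i => if i ∈ S then μ else 0
  have hindep : iIndepFun (fun i (x : Fin n → ℝ) => m i - x i) (altLaw μ S) :=
    iIndepFun_pi (X := fun i y => m i - y) fun i => by fun_prop
  have hcoord : ∀ i ∈ S, HasSubgaussianMGF (fun x : Fin n → ℝ => m i - x i) 1 (altLaw μ S) :=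
    fun i _ => by
      have hmp := measurePreserving_eval (fun i => gaussianReal (m i) 1) i
      have h := hasSubgaussianMGF_sub_gaussianReal (m i) 1
      rw [← hmp.map_eq] at h
      exact h.of_map hmp.measurable.aemeasurable
  have hsum : ∑ i ∈ S, m i = μ * S.card := by
    rw [Finset.sum_congr rfl fun i hi => if_pos hi, Finset.sum_const, nsmul_eq_mul, mul_comm]
  simpa [Finset.sum_sub_distrib, hsum] using
    HasSubgaussianMGF.sum_of_iIndepFun hindep hcoord

lemma measureReal_altLaw_sum_le (μ : ℝ) (S : Finset (Fin n)) {t : ℝ} (ht : 0 ≤ t) :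
    (altLaw μ S).real {x | ∑ i ∈ S, x i ≤ μ * S.card - t} ≤
      Real.exp (-t ^ 2 / (2 * S.card)) := by
  simpa [le_sub_comm] using (hasSubgaussianMGF_sum_altLaw μ S).measure_ge_le ht

end Alternative

section Risk

variable {n : ℕ} {C : Finset (Finset (Fin n))}

lemma risk_le_add {μ a b : ℝ} {f : (Fin n → ℝ) → Fin 2} (hC : C.Nonempty)
    (hnull : (nullLaw n).real {x | f x = 1} ≤ a)
    (halt : ∀ S ∈ C, (altLaw μ S).real {x | f x = 0} ≤ b) : risk C μ f ≤ a + b := by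
  refine add_le_add hnull ?_
  have hN : (0 : ℝ) < C.card := by exact_mod_cast hC.card_pos
  rw [one_div_mul_eq_div, div_le_iff₀ hN, mul_comm, ← nsmul_eq_mul]
  exact Finset.sum_le_card_nsmul _ _ _ halt

lemma maxTest_eq_one_iff (hC : C.Nonempty) {K : ℕ} {μ : ℝ} {x : Fin n → ℝ} :
    maxTest C hC K μ x = 1 ↔ (μ * K + scanMean C hC) / 2 ≤ scan C hC x := by
  unfold maxTest
  split_ifs with h <;> simp [h]

lemma maxTest_eq_zero_iff (hC : C.Nonempty) {K : ℕ} {μ : ℝ} {x : Fin n → ℝ} :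
    maxTest C hC K μ x = 0 ↔ scan C hC x < (μ * K + scanMean C hC) / 2 := by
  rw [← not_le, ← maxTest_eq_one_iff]
  omega

lemma risk_maxTest_le (hC : C.Nonempty) {K : ℕ} (hcard : ∀ S ∈ C, S.card = K) {μ : ℝ}
    (hμ : scanMean C hC ≤ μ * K) :
    risk C μ (maxTest C hC K μ) ≤
      2 * Real.exp (-((μ * K - scanMean C hC) / 2) ^ 2 / (2 * K)) := by
  have ht : 0 ≤ (μ * K - scanMean C hC) / 2 := by linarith
  rw [two_mul]
  refine risk_le_add hC ?_ fun S hS => ?_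
  · convert! measureReal_scan_ge_le hC (fun S hS => (hcard S hS).le) ht using 4 with x
    rw [maxTest_eq_one_iff]
    ring_nf
  · have : IsProbabilityMeasure (altLaw μ S) := by unfold altLaw; infer_instance
    have h := measureReal_altLaw_sum_le μ S ht
    rw [hcard S hS] at h
    refine (measureReal_mono fun x hx => ?_).trans h
    rw [Set.mem_ofPred_eq, maxTest_eq_zero_iff] at hx
    rw [Set.mem_ofPred_eq]
    linarith [sum_le_scan hC hS x]

lemma two_mul_exp_neg_sq_div_le {K t δ : ℝ} (hK : 0 < K) (hδ : 0 < δ)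
    (ht : K * √(2 / K * Real.log (2 / δ)) ≤ t) :
    2 * Real.exp (-t ^ 2 / (2 * K)) ≤ δ := by
  have hsq : 2 / K * Real.log (2 / δ) ≤ (t / K) ^ 2 :=
    Real.sqrt_le_iff.1 ((le_div_iff₀' hK).2 ht) |>.2
  have hlog : Real.log (2 / δ) ≤ t ^ 2 / (2 * K) := by
    calc Real.log (2 / δ) = K / 2 * (2 / K * Real.log (2 / δ)) := by field_simp
      _ ≤ K / 2 * (t / K) ^ 2 := by gcongr
      _ = t ^ 2 / (2 * K) := by field_simp
  have hexp : 2 / δ ≤ Real.exp (t ^ 2 / (2 * K)) := (Real.log_le_iff_le_exp (by positivity)).1 hlog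
  rwa [neg_div, Real.exp_neg, ← div_eq_mul_inv, div_le_comm₀ (Real.exp_pos _) hδ]

end Risk

end CombTest

theorem mainTheorem6 (n K : ℕ) (hK : 1 ≤ K) (C : Finset (Finset (Fin n))) (hC : C.Nonempty)
    (hcard : ∀ S ∈ C, S.card = K) (μ : ℝ) (hμ : 0 < μ) (δ : ℝ) (hδ : 0 < δ)
    (h : CombTest.scanMean C hC / K + 2 * Real.sqrt (2 / K * Real.log (2 / δ)) ≤ μ) :
    CombTest.risk C μ (CombTest.maxTest C hC K μ) ≤ δ := by
  have hK0 : (0 : ℝ) < K := by exact_mod_cast hK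
  have hgap : K * √(2 / K * Real.log (2 / δ)) ≤ (μ * K - CombTest.scanMean C hC) / 2 := by
    rw [← le_sub_iff_add_le, div_le_iff₀ hK0] at h
    linarith
  have hmean : CombTest.scanMean C hC ≤ μ * K := by
    linarith [mul_nonneg hK0.le (Real.sqrt_nonneg (2 / K * Real.log (2 / δ)))]
  exact (CombTest.risk_maxTest_le hC hcard hmean).trans
    (CombTest.two_mul_exp_neg_sq_div_le hK0 hδ hgap)
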